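/- Let $(M,g)$ be a (smooth, finite-dimensional) semi-Riemannian manifold, let $\epsilon\in\{1,-1\}$, and let $(\widehat M,\widehat g)=(\mathbb{R}_{>0}\times M,\ \epsilon\,\mathrm{d}r^2+r^2g)$ be the cone over $(M,g)$. Let $V$ be a smooth vector field on $\widehat M$ that is parallel for the Levi-Civita connection of $\widehat g$ and light-like, i.e. $V\neq 0$ and $\widehat g(V,V)=0$ at every point. Then the function $u=\widehat g(V,\partial_r)$ does not depend on $r$, hence is a smooth function on $M$, and, with $\nabla u$ denoting the gradient of $u$ with respect to $g$, the following hold. 1. Let $J\subset\mathbb{R}$ be an open interval containing $0$, and let $\gamma:J\to M$ be a geodesic of $(M,g)$ with $g(\gamma'(0),\gamma'(0))=-\epsilon$. Then $f=u\circ\gamma$ is smooth and satisfies $f''=f$ on $J$, and for all $t\in J$ $$f(t)=u(\gamma(0))\cosh t+g\bigl(\nabla u|_{\gamma(0)},\gamma'(0)\bigr)\sinh t .$$ 2. If $(M,g)$ is geodesically complete, then the image of $u$ contains $(0,\infty)$ whenever $u$ takes a positive value, and it contains $(-\infty,0)$ whenever $u$ takes a negative value. -/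

import Mathlib

open Set Filter
open scoped Manifold ContDiff Topology

noncomputable section

section SemiRiemannian

variable {E : Type*} [NormedAddCommGroup E] [NormedSpace ℝ E]
  {H : Type*} [TopologicalSpace H] (I : ModelWithCorners ℝ E H)
  (M : Type*) [TopologicalSpace M] [ChartedSpace H M] [IsManifold I ∞ M]

/-- A semi-Riemannian metric on `M`: a smooth section of the bundle of bilinear forms on the
tangent spaces which is symmetric and nondegenerate at every point. -/
structure SemiRiemannianMetric where
  /-- The bilinear form on the tangent space at `p`. -/
  form (p : M) : TangentSpace I p →L[ℝ] TangentSpace I p →L[ℝ] ℝ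
  symm (p : M) (v w : TangentSpace I p) : form p v w = form p w v
  nondegenerate (p : M) (v : TangentSpace I p) (hv : ∀ w, form p v w = 0) : v = 0
  contMDiff : ContMDiff I (I.prod 𝓘(ℝ, E →L[ℝ] E →L[ℝ] ℝ)) ∞
    (fun p ↦ Bundle.TotalSpace.mk' (E →L[ℝ] E →L[ℝ] ℝ)
      (E := fun p ↦ TangentSpace I p →L[ℝ] TangentSpace I p →L[ℝ] ℝ) p (form p))

variable {I M}

/-- The vector of `T_q M` whose components in the chart centred at `p` are given by an element of
`E` (the inverse of the differential of the chart), as a linear map. -/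
def ofChart (I : ModelWithCorners ℝ E H) [IsManifold I ∞ M] (p q : M) :
    E →L[ℝ] TangentSpace I q :=
  (trivializationAt E (TangentSpace I) p).symmL ℝ q

/-- The components in the chart centred at `p` of tangent vectors at `q`
(the differential of the chart). -/
def toChart (I : ModelWithCorners ℝ E H) [IsManifold I ∞ M] (p q : M) :
    TangentSpace I q →L[ℝ] E :=
  (trivializationAt E (TangentSpace I) p).continuousLinearMapAt ℝ q

/-- The bilinear form `(v, w) ↦ B(A v, A w)`. -/
def pullbackForm {F F' : Type*} [AddCommGroup F] [Module ℝ F] [TopologicalSpace F]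
    [IsTopologicalAddGroup F] [ContinuousSMul ℝ F]
    [AddCommGroup F'] [Module ℝ F'] [TopologicalSpace F']
    [IsTopologicalAddGroup F'] [ContinuousSMul ℝ F']
    (B : F →L[ℝ] F →L[ℝ] ℝ) (A : F' →L[ℝ] F) : F' →L[ℝ] F' →L[ℝ] ℝ :=
  (ContinuousLinearMap.precomp ℝ A).comp (B.comp A)

/-- The Christoffel symbols of the first kind of a metric `G` on an open set of `E`, at `x`:
`c ↦ ½ (∂_a G(b, c) + ∂_b G(a, c) - ∂_c G(a, b))` for constant vectors `a`, `b`, `c`. -/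
def christoffelFirst (G : E → E →L[ℝ] E →L[ℝ] ℝ) (x a b : E) : E →L[ℝ] ℝ :=
  (1 / 2 : ℝ) • (fderiv ℝ G x a b + fderiv ℝ G x b a - ((fderiv ℝ G x).flip a).flip b)

/-- The velocity `γ'(t)` of a curve in `M`. -/
def velocity (I : ModelWithCorners ℝ E H) (γ : ℝ → M) (t : ℝ) : TangentSpace I (γ t) :=
  mfderiv 𝓘(ℝ, ℝ) I γ t (1 : ℝ)

namespace SemiRiemannianMetric

variable (g : SemiRiemannianMetric I M)

/-- The metric in the chart centred at `p`: the components `g_{ij}(x)`, written invariantly as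
a bilinear form on `E` that depends on the point `x` of the chart domain in `E`. -/
def inChart (p : M) (x : E) : E →L[ℝ] E →L[ℝ] ℝ :=
  pullbackForm (g.form ((extChartAt I p).symm x)) (ofChart I p ((extChartAt I p).symm x))

/-- The Christoffel symbols of the first kind at `p`, in the chart centred at `p`. -/
def christoffel (p : M) (a b : E) : E →L[ℝ] ℝ :=
  christoffelFirst (g.inChart p) (extChartAt I p p) a b

variable [FiniteDimensional ℝ E]

theorem exists_sharp (p : M) (l : TangentSpace I p →L[ℝ] ℝ) :
    ∃ v : TangentSpace I p, ∀ w, g.form p v w = l w := by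
  have : FiniteDimensional ℝ (TangentSpace I p) := inferInstanceAs (FiniteDimensional ℝ E)
  let B : TangentSpace I p →ₗ[ℝ] Module.Dual ℝ (TangentSpace I p) :=
    { toFun := fun v ↦ (g.form p v).toLinearMap
      map_add' := fun v w ↦ by ext; simp
      map_smul' := fun c v ↦ by ext; simp }
  have hB : Function.Injective B := by
    rw [injective_iff_map_eq_zero]
    intro v hv
    exact g.nondegenerate p v fun w ↦ by simpa [B] using congrArg (fun f ↦ f w) hv
  have hS : Function.Surjective B :=
    (LinearMap.injective_iff_surjective_of_finrank_eq_finrank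
      Subspace.dual_finrank_eq.symm).1 hB
  obtain ⟨v, hv⟩ := hS l.toLinearMap
  exact ⟨v, fun w ↦ by simpa [B] using congrArg (fun f ↦ f w) hv⟩

/-- The vector `v` of `T_p M` that is metrically dual to the covector `l`:
`g(v, w) = l(w)` for all `w`. -/
def sharp (p : M) (l : TangentSpace I p →L[ℝ] ℝ) : TangentSpace I p :=
  (g.exists_sharp p l).choose

theorem form_sharp (p : M) (l : TangentSpace I p →L[ℝ] ℝ) (w : TangentSpace I p) :
    g.form p (g.sharp p l) w = l w :=
  (g.exists_sharp p l).choose_spec w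

/-- The gradient of a function: `g(∇u, w) = du(w)`. -/
def gradient (u : M → ℝ) (p : M) : TangentSpace I p :=
  g.sharp p (mfderiv I 𝓘(ℝ, ℝ) u p)

/-- The Christoffel symbols of the second kind at `p`, in the chart centred at `p`,
as the tangent vector `Γ(a, b) = Γ^k_{ij} a^i b^j ∂_k`. -/
def christoffelVec (p : M) (a b : E) : TangentSpace I p :=
  g.sharp p ((g.christoffel p a b).comp (toChart I p p))

/-- The Levi-Civita covariant derivative `∇_a V` at `p`, computed in the chart centred at `p`:
`(∇_a V)^k = ∂_a V^k + Γ^k_{ij} a^i V^j`. -/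
def covDeriv (V : ∀ q : M, TangentSpace I q) (p : M) (a : TangentSpace I p) : TangentSpace I p :=
  ofChart I p p (fderiv ℝ
      (fun x ↦ toChart I p ((extChartAt I p).symm x) (V ((extChartAt I p).symm x)))
      (extChartAt I p p) (toChart I p p a))
    + g.christoffelVec p (toChart I p p a) (toChart I p p (V p))

/-- A vector field is parallel for the Levi-Civita connection if it is smooth and `∇V = 0`. -/
def IsParallel (V : ∀ q : M, TangentSpace I q) : Prop :=
  ContMDiff I (I.prod 𝓘(ℝ, E)) ∞ (fun q ↦ (⟨q, V q⟩ : TangentBundle I M)) ∧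
    ∀ p (a : TangentSpace I p), g.covDeriv V p a = 0

/-- A vector is light-like if it is nonzero and null. -/
def IsLightLike (p : M) (v : TangentSpace I p) : Prop :=
  v ≠ 0 ∧ g.form p v v = 0

/-- The covariant acceleration `∇_{γ'} γ'` of a curve at time `t`, computed in the chart centred
at `γ t`: `(γ^k)'' + Γ^k_{ij} (γ^i)' (γ^j)'`. -/
def acceleration (γ : ℝ → M) (t : ℝ) : TangentSpace I (γ t) :=
  ofChart I (γ t) (γ t) (iteratedDeriv 2 (fun s ↦ extChartAt I (γ t) (γ s)) t)
    + g.christoffelVec (γ t) (deriv (fun s ↦ extChartAt I (γ t) (γ s)) t)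
        (deriv (fun s ↦ extChartAt I (γ t) (γ s)) t)

/-- `γ` is a geodesic on the open interval `J` if it is smooth there with `∇_{γ'} γ' = 0`. -/
def IsGeodesicOn (γ : ℝ → M) (J : Set ℝ) : Prop :=
  ContMDiffOn 𝓘(ℝ, ℝ) I ∞ γ J ∧ ∀ t ∈ J, g.acceleration γ t = 0

/-- Geodesic completeness: every tangent vector is the initial velocity of a geodesic defined on
all of `ℝ`. -/
def IsComplete : Prop :=
  ∀ ξ : TangentBundle I M, ∃ γ : ℝ → M, g.IsGeodesicOn γ univ ∧
    (⟨γ 0, velocity I γ 0⟩ : TangentBundle I M) = ξ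

end SemiRiemannianMetric

end SemiRiemannian

section Cone

/-- The half-line `ℝ_{>0}`, as an open submanifold of `ℝ`. -/
def posReals : TopologicalSpace.Opens ℝ := ⟨Ioi 0, isOpen_Ioi⟩

/-- The manifold `ℝ_{>0} × M`. -/
abbrev Cone (M : Type*) : Type _ := posReals × M

variable {E : Type*} [NormedAddCommGroup E] [NormedSpace ℝ E]
  {H : Type*} [TopologicalSpace H] {I : ModelWithCorners ℝ E H}
  {M : Type*} [TopologicalSpace M] [ChartedSpace H M] [IsManifold I ∞ M]

/-- The model of the manifold `ℝ_{>0} × M`. -/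
abbrev coneModel (I : ModelWithCorners ℝ E H) : ModelWithCorners ℝ (ℝ × E) (ModelProd ℝ H) :=
  𝓘(ℝ, ℝ).prod I

/-- The differential `dr` of the projection to `ℝ_{>0}`. -/
def coneDr (I : ModelWithCorners ℝ E H) (q : Cone M) : TangentSpace (coneModel I) q →L[ℝ] ℝ :=
  ContinuousLinearMap.fst ℝ ℝ E

/-- The differential of the projection to `M`. -/
def coneDproj (I : ModelWithCorners ℝ E H) (q : Cone M) :
    TangentSpace (coneModel I) q →L[ℝ] TangentSpace I q.2 :=
  ContinuousLinearMap.snd ℝ ℝ E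

/-- The radial vector field `∂_r`. -/
def radial (I : ModelWithCorners ℝ E H) (q : Cone M) : TangentSpace (coneModel I) q :=
  ((1, 0) : ℝ × E)

/-- The bilinear form `ε dr² + r² g` at a point of the cone. -/
def coneForm (g : SemiRiemannianMetric I M) (ε : ℝ) (q : Cone M) :
    TangentSpace (coneModel I) q →L[ℝ] TangentSpace (coneModel I) q →L[ℝ] ℝ :=
  ε • pullbackForm (ContinuousLinearMap.mul ℝ ℝ) (coneDr I q)
    + (q.1 : ℝ) ^ 2 • pullbackForm (g.form q.2) (coneDproj I q)

theorem coneForm_apply (g : SemiRiemannianMetric I M) (ε : ℝ) (q : Cone M)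
    (v w : TangentSpace (coneModel I) q) :
    coneForm g ε q v w = ε * (coneDr I q v * coneDr I q w)
      + (q.1 : ℝ) ^ 2 * g.form q.2 (coneDproj I q v) (coneDproj I q w) := rfl

theorem trivializationAt_form (p q : M) (hq : q ∈ (chartAt H p).source)
    (B : TangentSpace I q →L[ℝ] TangentSpace I q →L[ℝ] ℝ) :
    (trivializationAt (E →L[ℝ] E →L[ℝ] ℝ)
      (fun p : M ↦ TangentSpace I p →L[ℝ] TangentSpace I p →L[ℝ] ℝ) p ⟨q, B⟩).2 =
      pullbackForm B (ofChart I p q) := by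
  have hq' : q ∈ (trivializationAt E (TangentSpace I) p).baseSet := by simpa using hq
  ext v w
  rw [hom_trivializationAt_apply]
  refine (inCoordinates_apply_eq₂ (F₁ := E) (F₂ := E) (F₃ := ℝ) (E₁ := TangentSpace I)
    (E₂ := TangentSpace I) (E₃ := Bundle.Trivial M ℝ) hq' hq' (Set.mem_univ _)).trans ?_
  simp only [Bundle.Trivial.fiberBundle_trivializationAt', Bundle.Trivial.linearMapAt_trivialization]
  change B _ _ = B ((trivializationAt E (TangentSpace I) p).symmL ℝ q v)
    ((trivializationAt E (TangentSpace I) p).symmL ℝ q w)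
  rw [Bundle.Trivialization.symmL_apply _ hq', Bundle.Trivialization.symmL_apply _ hq']

theorem mem_chartAt_posReals (r₀ r : posReals) : r ∈ (chartAt ℝ r₀).source := by
  simp [TopologicalSpace.Opens.chartAt_eq, chartAt_self_eq]

theorem toChart_posReals (r₀ r : posReals) :
    toChart 𝓘(ℝ, ℝ) r₀ r = ContinuousLinearMap.id ℝ ℝ := by
  unfold toChart
  rw [TangentBundle.continuousLinearMapAt_trivializationAt_eq_core (mem_chartAt_posReals r₀ r)]
  ext
  exact (tangentBundleCore 𝓘(ℝ, ℝ) posReals).coordChange_self (achart ℝ r) r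
    (mem_chartAt_posReals r r) 1

theorem mem_chartAt_cone (q₀ q : Cone M) (hq : q.2 ∈ (chartAt H q₀.2).source) :
    q ∈ (chartAt (ModelProd ℝ H) q₀).source := by
  simp [hq, mem_chartAt_posReals q₀.1 q.1]

theorem toChart_cone (q₀ q : Cone M) (hq : q.2 ∈ (chartAt H q₀.2).source)
    (w : TangentSpace (coneModel I) q) :
    toChart (coneModel I) q₀ q w = (coneDr I q w, toChart I q₀.2 q.2 (coneDproj I q w)) := by
  have hr := mem_chartAt_posReals q₀.1 q.1
  have h3 : mfderiv 𝓘(ℝ, ℝ) 𝓘(ℝ, ℝ) (extChartAt 𝓘(ℝ, ℝ) q₀.1) q.1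
      = ContinuousLinearMap.id ℝ ℝ := by
    rw [← TangentBundle.continuousLinearMapAt_trivializationAt hr]
    exact toChart_posReals q₀.1 q.1
  have h := mfderiv_prodMap (p := q) (mdifferentiableAt_extChartAt (I := 𝓘(ℝ, ℝ)) hr)
    (mdifferentiableAt_extChartAt (I := I) hq)
  rw [h3, ← modelWithCornersSelf_prod, chartedSpaceSelf_prod] at h
  unfold toChart
  rw [TangentBundle.continuousLinearMapAt_trivializationAt (mem_chartAt_cone q₀ q hq),
    TangentBundle.continuousLinearMapAt_trivializationAt hq, extChartAt_prod]
  exact congrArg (fun L : (ℝ × E) →L[ℝ] (ℝ × E) ↦ L w) h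

theorem ofChart_cone (q₀ q : Cone M) (hq : q.2 ∈ (chartAt H q₀.2).source) (v : ℝ × E) :
    ofChart (coneModel I) q₀ q v = ((v.1, ofChart I q₀.2 q.2 v.2) : ℝ × E) := by
  have h1 : q ∈ (trivializationAt (ℝ × E) (TangentSpace (coneModel I)) q₀).baseSet :=
    mem_chartAt_cone q₀ q hq
  have h2 : q.2 ∈ (trivializationAt E (TangentSpace I) q₀.2).baseSet := hq
  set w : TangentSpace (coneModel I) q := ((v.1, ofChart I q₀.2 q.2 v.2) : ℝ × E) with hw
  have h : toChart (coneModel I) q₀ q w = v := by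
    rw [toChart_cone q₀ q hq]
    refine Prod.ext rfl ?_
    exact (trivializationAt E (TangentSpace I) q₀.2).continuousLinearMapAt_symmL h2 v.2
  rw [← h]
  exact (trivializationAt (ℝ × E) (TangentSpace (coneModel I)) q₀).symmL_continuousLinearMapAt
    h1 w

theorem contMDiff_coneForm (g : SemiRiemannianMetric I M) (ε : ℝ) :
    ContMDiff (coneModel I) ((coneModel I).prod 𝓘(ℝ, (ℝ × E) →L[ℝ] (ℝ × E) →L[ℝ] ℝ)) ∞
      (fun q : Cone M ↦ Bundle.TotalSpace.mk' ((ℝ × E) →L[ℝ] (ℝ × E) →L[ℝ] ℝ)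
        (E := fun q : Cone M ↦ TangentSpace (coneModel I) q →L[ℝ]
          TangentSpace (coneModel I) q →L[ℝ] ℝ) q (coneForm g ε q)) := by
  intro q₀
  rw [Bundle.contMDiffAt_section]
  have hg := g.contMDiff q₀.2
  rw [Bundle.contMDiffAt_section] at hg
  have hg' := hg.comp q₀ (contMDiffAt_snd (I := 𝓘(ℝ, ℝ)) (J := I) (n := ∞) (p := q₀))
  have hr : ContMDiffAt (coneModel I) 𝓘(ℝ, ℝ) ∞ (fun q : Cone M ↦ (q.1 : ℝ)) q₀ :=
    (contMDiff_subtype_val (U := posReals)).contMDiffAt.comp q₀ contMDiffAt_fst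
  have hP := (contMDiffAt_const (c := ContinuousLinearMap.precomp ℝ
    (ContinuousLinearMap.snd ℝ ℝ E))).clm_comp (hg'.clm_comp
      (contMDiffAt_const (c := ContinuousLinearMap.snd ℝ ℝ E)))
  have hmain := (contMDiffAt_const (c := ε • pullbackForm (ContinuousLinearMap.mul ℝ ℝ)
    (ContinuousLinearMap.fst ℝ ℝ E))).add ((hr.pow 2).smul hP)
  refine hmain.congr_of_eventuallyEq ?_
  have hs : {q : Cone M | q.2 ∈ (chartAt H q₀.2).source} ∈ 𝓝 q₀ :=
    continuous_snd.continuousAt ((chartAt H q₀.2).open_source.mem_nhds (mem_chart_source H q₀.2))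
  filter_upwards [hs] with q hq
  rw [trivializationAt_form q₀ q (mem_chartAt_cone q₀ q hq)]
  simp only [Function.comp_apply, Pi.add_apply, Pi.smul_apply']
  rw [trivializationAt_form q₀.2 q.2 hq]
  refine ContinuousLinearMap.ext fun v ↦ ContinuousLinearMap.ext fun w ↦ ?_
  change coneForm g ε q (ofChart (coneModel I) q₀ q v) (ofChart (coneModel I) q₀ q w) = _
  rw [ofChart_cone q₀ q hq, ofChart_cone q₀ q hq]
  rfl

/-- The cone metric `ε dr² + r² g` on `ℝ_{>0} × M`, for `ε = ±1`. -/
def coneMetric (g : SemiRiemannianMetric I M) (ε : ℝ) (hε : ε = 1 ∨ ε = -1) :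
    SemiRiemannianMetric (coneModel I) (Cone M) where
  form := coneForm g ε
  symm q v w := by
    rw [coneForm_apply, coneForm_apply, g.symm, mul_comm (coneDr I q v)]
  nondegenerate q v hv := by
    have hr : (q.1 : ℝ) ≠ 0 := ne_of_gt q.1.2
    have h1 : coneDr I q v = 0 := by
      have h := hv (radial I q)
      rw [coneForm_apply, show coneDr I q (radial I q) = 1 from rfl,
        show coneDproj I q (radial I q) = 0 from rfl] at h
      rcases hε with rfl | rfl <;> simpa using h
    have h2 : coneDproj I q v = 0 := by
      apply g.nondegenerate
      intro w
      have h := hv (show TangentSpace (coneModel I) q from ((0, w) : ℝ × E))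
      rw [coneForm_apply, h1] at h
      have h' : (q.1 : ℝ) ^ 2 * g.form q.2 (coneDproj I q v) w = 0 := by
        simpa using! h
      simpa [hr] using h'
    exact Prod.ext h1 h2
  contMDiff := contMDiff_coneForm g ε

end Cone

end

/-!
Write `V = a ∂_r + W` with `W` tangent to the slices `{r} × M`, and `u = ĝ(V, ∂_r) = ε a`. For a
parallel field `V` the derivative of `ĝ(V, ∂_r)` is `r g(W, ·)`, because `∇̂_X ∂_r` is the
projection of `X` to `TM` divided by `r`. Hence `u` does not depend on `r`, and `W` at `r = 1` is
the gradient of `u`. The part of `∇̂V = 0` tangent to the slice `r = 1` then reads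
`∇_X ∇u = -ε u X`, so `f = u ∘ γ` satisfies `f'' = -ε g(γ', γ') f` along every geodesic `γ`.

If `V` is moreover null, then `g(∇u, ∇u) = -ε u²`. At a point where `u ≠ 0` the vector
`-(ε u)⁻¹ ∇u` therefore has square length `-ε`, and along the geodesic with this initial velocity
`f'(0) = f(0)`, so that `f(t) = f(0) eᵗ`.
-/

section Calculus

variable {F : Type*} [NormedAddCommGroup F] [NormedSpace ℝ F]

theorem eq_of_hasDerivAt_zero {J : Set ℝ} (hJ : IsOpen J) (hJc : IsPreconnected J) {f : ℝ → F}
    (hf : ∀ t ∈ J, HasDerivAt f 0 t) {s t : ℝ} (hs : s ∈ J) (ht : t ∈ J) : f s = f t :=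
  hJ.is_const_of_deriv_eq_zero hJc
    (fun t ht ↦ (hf t ht).differentiableAt.differentiableWithinAt) (fun t ht ↦ (hf t ht).deriv)
    hs ht

theorem iteratedDeriv_two_eq_of_hasDerivAt {f f' : ℝ → F} {f'' : F} {t : ℝ}
    (hf : ∀ᶠ s in 𝓝 t, HasDerivAt f (f' s) s) (hf' : HasDerivAt f' f'' t) :
    iteratedDeriv 2 f t = f'' := by
  have hderiv : deriv f =ᶠ[𝓝 t] f' := hf.mono fun _ hs ↦ hs.deriv
  rw [iteratedDeriv_succ, iteratedDeriv_one, hderiv.deriv_eq, hf'.deriv]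

theorem differentiableAt_deriv_of_contDiffAt {f : ℝ → F} {t : ℝ} (hf : ContDiffAt ℝ 2 f t) :
    DifferentiableAt ℝ (deriv f) t :=
  ((hf.fderiv_right (m := 1) (by norm_num)).differentiableAt one_ne_zero).clm_apply
    (differentiableAt_const 1)

theorem eq_cosh_add_sinh_of_hasDerivAt {J : Set ℝ} (hJ : IsOpen J) (hJc : IsPreconnected J)
    (h0 : 0 ∈ J) {f f' : ℝ → ℝ} (hf : ∀ t ∈ J, HasDerivAt f (f' t) t)
    (hf' : ∀ t ∈ J, HasDerivAt f' (f t) t) {t : ℝ} (ht : t ∈ J) :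
    f t = f 0 * Real.cosh t + f' 0 * Real.sinh t := by
  have hfst : f t * Real.cosh t - f' t * Real.sinh t = f 0 := by
    refine (eq_of_hasDerivAt_zero (f := fun s ↦ f s * Real.cosh s - f' s * Real.sinh s)
      hJ hJc (fun s hs ↦ ?_) ht h0).trans (by simp)
    exact (((hf s hs).mul (Real.hasDerivAt_cosh s)).sub
      ((hf' s hs).mul (Real.hasDerivAt_sinh s))).congr_deriv (by ring)
  have hsnd : f' t * Real.cosh t - f t * Real.sinh t = f' 0 := by
    refine (eq_of_hasDerivAt_zero (f := fun s ↦ f' s * Real.cosh s - f s * Real.sinh s)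
      hJ hJc (fun s hs ↦ ?_) ht h0).trans (by simp)
    exact (((hf' s hs).mul (Real.hasDerivAt_cosh s)).sub
      ((hf s hs).mul (Real.hasDerivAt_sinh s))).congr_deriv (by ring)
  rw [← hfst, ← hsnd]
  linear_combination (-f t) * Real.cosh_sq_sub_sinh_sq t

end Calculus

section Charts

variable {E : Type*} [NormedAddCommGroup E] [NormedSpace ℝ E]
  {H : Type*} [TopologicalSpace H] {I : ModelWithCorners ℝ E H}
  {M : Type*} [TopologicalSpace M] [ChartedSpace H M]
  {F : Type*} [NormedAddCommGroup F] [NormedSpace ℝ F]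

theorem hasDerivAt_comp_curve {f : M → F} {γ : ℝ → M} {t : ℝ}
    (hf : MDifferentiableAt I 𝓘(ℝ, F) f (γ t)) (hγ : MDifferentiableAt 𝓘(ℝ, ℝ) I γ t) :
    HasDerivAt (fun s ↦ f (γ s)) (mfderiv I 𝓘(ℝ, F) f (γ t) (velocity I γ t)) t := by
  have h : HasFDerivAt (fun s ↦ f (γ s))
      (mfderiv I 𝓘(ℝ, F) f (γ t) ∘L mfderiv 𝓘(ℝ, ℝ) I γ t : ℝ →L[ℝ] F) t :=
    (hf.hasMFDerivAt.comp t hγ.hasMFDerivAt).hasFDerivAt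
  exact h.hasDerivAt

theorem isLocallyConstant_of_mfderiv_eq_zero [I.Boundaryless] {f : M → F}
    [IsManifold I 1 M]
    (hf : MDifferentiable I 𝓘(ℝ, F) f) (hf' : ∀ p, mfderiv I 𝓘(ℝ, F) f p = 0) :
    IsLocallyConstant f := by
  rw [IsLocallyConstant.iff_eventually_eq]
  intro p
  have hderiv (x : E) (hx : x ∈ (extChartAt I p).target) :
      HasFDerivAt (f ∘ (extChartAt I p).symm) (0 : E →L[ℝ] F) x := by
    have hsymm : MDifferentiableAt 𝓘(ℝ, E) I (extChartAt I p).symm x :=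
      ((contMDiffOn_extChartAt_symm (n := 1) p).contMDiffAt
        (extChartAt_target_mem_nhds' hx)).mdifferentiableAt one_ne_zero
    have hcomp := (hf _).hasMFDerivAt.comp x hsymm.hasMFDerivAt
    rw [hf', ContinuousLinearMap.zero_comp] at hcomp
    exact hcomp.hasFDerivAt
  obtain ⟨δ, hδ, hball⟩ := Metric.mem_nhds_iff.1 (extChartAt_target_mem_nhds (I := I) p)
  have hnear : ∀ᶠ q in 𝓝 p, extChartAt I p q ∈ Metric.ball (extChartAt I p p) δ :=
    (continuousAt_extChartAt p).eventually (Metric.ball_mem_nhds _ hδ)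
  filter_upwards [hnear, extChartAt_source_mem_nhds (I := I) p] with q hq hqs
  have hconst := Metric.isOpen_ball.is_const_of_fderiv_eq_zero
    (convex_ball (extChartAt I p p) δ).isPreconnected
    (fun x hx ↦ (hderiv x (hball hx)).differentiableAt.differentiableWithinAt)
    (fun x hx ↦ (hderiv x (hball hx)).fderiv) hq (Metric.mem_ball_self hδ)
  simpa only [Function.comp_apply, (extChartAt I p).left_inv hqs, extChartAt_to_inv] using hconst

theorem eventually_extChartAt_symm_mem_source [I.Boundaryless] (p : M) :
    ∀ᶠ x in 𝓝 (extChartAt I p p), (extChartAt I p).symm x ∈ (chartAt H p).source := by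
  filter_upwards [extChartAt_target_mem_nhds (I := I) p] with x hx
  simpa only [extChartAt_source] using (extChartAt I p).map_target hx

theorem differentiableAt_comp_extChartAt_symm [I.Boundaryless] {f : M → F} {p : M}
    (hf : MDifferentiableAt I 𝓘(ℝ, F) f p) :
    DifferentiableAt ℝ (fun x ↦ f ((extChartAt I p).symm x)) (extChartAt I p p) := by
  have := ((mdifferentiableAt_iff _ _).1 hf).2
  rwa [I.range_eq_univ, differentiableWithinAt_univ] at this

variable [IsManifold I ∞ M]

theorem ofChart_toChart {p q : M} (hq : q ∈ (chartAt H p).source) (v : TangentSpace I q) :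
    ofChart I p q (toChart I p q v) = v :=
  (trivializationAt E (TangentSpace I) p).symmL_continuousLinearMapAt hq v

theorem trivializationAt_tangentSpace_apply {p q : M} (hq : q ∈ (chartAt H p).source)
    (v : TangentSpace I q) :
    (trivializationAt E (TangentSpace I) p ⟨q, v⟩).2 = toChart I p q v :=
  (congrFun (Bundle.Trivialization.coe_linearMapAt_of_mem _ hq) v).symm

theorem toChart_eq_mfderiv {p q : M} (hq : q ∈ (chartAt H p).source) :
    toChart I p q = mfderiv I 𝓘(ℝ, E) (extChartAt I p) q :=
  TangentBundle.continuousLinearMapAt_trivializationAt hq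

theorem mfderiv_eq_fderiv_comp_toChart [I.Boundaryless] {f : M → F} {p : M}
    (hf : MDifferentiableAt I 𝓘(ℝ, F) f p) (v : TangentSpace I p) :
    mfderiv I 𝓘(ℝ, F) f p v
      = fderiv ℝ (fun x ↦ f ((extChartAt I p).symm x)) (extChartAt I p p) (toChart I p p v) := by
  have htoChart : toChart I p p v = v := by
    unfold toChart
    rw [TangentBundle.continuousLinearMapAt_trivializationAt_eq_core (mem_chart_source H p)]
    exact (tangentBundleCore I M).coordChange_self (achart H p) p (mem_chart_source H p) v
  rw [htoChart, hf.mfderiv, I.range_eq_univ, fderivWithin_univ]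
  rfl

theorem hasDerivAt_extChartAt_comp_curve {γ : ℝ → M} {t : ℝ} {p : M}
    (hγ : MDifferentiableAt 𝓘(ℝ, ℝ) I γ t) (ht : γ t ∈ (chartAt H p).source) :
    HasDerivAt (fun s ↦ extChartAt I p (γ s)) (toChart I p (γ t) (velocity I γ t)) t := by
  rw [toChart_eq_mfderiv ht]
  exact hasDerivAt_comp_curve (mdifferentiableAt_extChartAt ht) hγ

/-- The components of the vector field `V` in the chart centred at `p`, as a function on the
chart domain in `E`. -/
noncomputable def chartComponents (V : ∀ q : M, TangentSpace I q) (p : M) (x : E) : E :=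
  toChart I p ((extChartAt I p).symm x) (V ((extChartAt I p).symm x))

theorem chartComponents_extChartAt (V : ∀ q : M, TangentSpace I q) {p q : M}
    (hq : q ∈ (chartAt H p).source) :
    chartComponents V p (extChartAt I p q) = toChart I p q (V q) := by
  rw [chartComponents, (extChartAt I p).left_inv (by rwa [extChartAt_source])]

theorem hasFDerivAt_chartComponents [I.Boundaryless] {V : ∀ q : M, TangentSpace I q} {p : M}
    (hV : MDiffAt (T% V) p) :
    HasFDerivAt (chartComponents V p) (fderiv ℝ (chartComponents V p) (extChartAt I p p))
      (extChartAt I p p) := by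
  rw [mdifferentiableAt_section] at hV
  have hdiff := differentiableAt_comp_extChartAt_symm hV
  refine (hdiff.congr_of_eventuallyEq ?_).hasFDerivAt
  filter_upwards [eventually_extChartAt_symm_mem_source (I := I) p] with x hx
  exact (trivializationAt_tangentSpace_apply hx _).symm

theorem hasDerivAt_toChart_comp_curve [I.Boundaryless] {V : ∀ q : M, TangentSpace I q}
    {γ : ℝ → M} {t : ℝ} (hV : MDiffAt (T% V) (γ t)) (hγ : MDifferentiableAt 𝓘(ℝ, ℝ) I γ t) :
    HasDerivAt (fun s ↦ toChart I (γ t) (γ s) (V (γ s)))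
      (fderiv ℝ (chartComponents V (γ t)) (extChartAt I (γ t) (γ t))
        (toChart I (γ t) (γ t) (velocity I γ t))) t := by
  have hp := mem_chart_source H (γ t)
  refine (HasFDerivAt.comp_hasDerivAt (l := chartComponents V (γ t)) t
    (hasFDerivAt_chartComponents hV)
    (hasDerivAt_extChartAt_comp_curve hγ hp)).congr_of_eventuallyEq ?_
  filter_upwards [hγ.continuousAt ((chartAt H (γ t)).open_source.mem_nhds hp)] with s hs
  exact (chartComponents_extChartAt V hs).symm

theorem differentiableAt_toChart_velocity {γ : ℝ → M} {t : ℝ}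
    (hγ : ContMDiffAt 𝓘(ℝ, ℝ) I 2 γ t) :
    DifferentiableAt ℝ (fun s ↦ toChart I (γ t) (γ s) (velocity I γ s)) t := by
  have hp := mem_chart_source H (γ t)
  have hchart : ContDiffAt ℝ 2 (fun s ↦ extChartAt I (γ t) (γ s)) t :=
    contMDiffAt_iff_contDiffAt.1 ((contMDiffAt_extChartAt' hp).comp t hγ)
  have hmdiff : ∀ᶠ s in 𝓝 t, MDifferentiableAt 𝓘(ℝ, ℝ) I γ s :=
    ((contMDiffAt_iff_contMDiffAt_nhds (by simp)).1 hγ).mono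
      fun _ hs ↦ hs.mdifferentiableAt two_ne_zero
  refine (differentiableAt_deriv_of_contDiffAt hchart).congr_of_eventuallyEq ?_
  filter_upwards [hmdiff, hγ.continuousAt ((chartAt H (γ t)).open_source.mem_nhds hp)]
    with s hs hs'
  exact (hasDerivAt_extChartAt_comp_curve hs hs').deriv.symm

end Charts

namespace SemiRiemannianMetric

section LeviCivita

variable {E : Type*} [NormedAddCommGroup E] [NormedSpace ℝ E]
  {H : Type*} [TopologicalSpace H] {I : ModelWithCorners ℝ E H}
  {M : Type*} [TopologicalSpace M] [ChartedSpace H M] [IsManifold I ∞ M]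
  (g : SemiRiemannianMetric I M)

theorem inChart_extChartAt {p q : M} (hq : q ∈ (chartAt H p).source) (a b : E) :
    g.inChart p (extChartAt I p q) a b = g.form q (ofChart I p q a) (ofChart I p q b) := by
  unfold inChart
  rw [(extChartAt I p).left_inv (by rwa [extChartAt_source])]
  rfl

theorem inChart_toChart {p q : M} (hq : q ∈ (chartAt H p).source) (v w : TangentSpace I q) :
    g.inChart p (extChartAt I p q) (toChart I p q v) (toChart I p q w) = g.form q v w := by
  rw [g.inChart_extChartAt hq, ofChart_toChart hq, ofChart_toChart hq]

theorem inChart_symm (p : M) (x a b : E) : g.inChart p x a b = g.inChart p x b a :=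
  g.symm _ _ _

theorem hasFDerivAt_inChart [I.Boundaryless] (p : M) :
    HasFDerivAt (g.inChart p) (fderiv ℝ (g.inChart p) (extChartAt I p p)) (extChartAt I p p) := by
  have hform := (Bundle.contMDiffAt_section (s := g.form) p).1 (g.contMDiff p)
  have hdiff := differentiableAt_comp_extChartAt_symm (hform.mdifferentiableAt (by simp))
  refine (hdiff.congr_of_eventuallyEq ?_).hasFDerivAt
  filter_upwards [eventually_extChartAt_symm_mem_source (I := I) p] with x hx
  exact (trivializationAt_form p _ hx _).symm

theorem hasFDerivAt_inChart_apply [I.Boundaryless] (p : M) (b c : E) :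
    HasFDerivAt (fun x ↦ g.inChart p x b c)
      (((fderiv ℝ (g.inChart p) (extChartAt I p p)).flip b).flip c) (extChartAt I p p) := by
  have h := ((g.hasFDerivAt_inChart p).clm_apply
    (hasFDerivAt_const b _)).clm_apply (hasFDerivAt_const c _)
  convert! h using 1
  ext a
  simp

theorem fderiv_inChart_symm [I.Boundaryless] (p : M) (a b c : E) :
    fderiv ℝ (g.inChart p) (extChartAt I p p) a b c
      = fderiv ℝ (g.inChart p) (extChartAt I p p) a c b := by
  have hbc := g.hasFDerivAt_inChart_apply p b c
  simp only [fun x ↦ g.inChart_symm p x b c] at hbc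
  exact congrArg (fun L : E →L[ℝ] ℝ ↦ L a) (hbc.unique (g.hasFDerivAt_inChart_apply p c b))

theorem christoffel_apply (p : M) (a b c : E) :
    g.christoffel p a b c = 1 / 2 * (fderiv ℝ (g.inChart p) (extChartAt I p p) a b c
      + fderiv ℝ (g.inChart p) (extChartAt I p p) b a c
      - fderiv ℝ (g.inChart p) (extChartAt I p p) c a b) := by
  simp [christoffel, christoffelFirst]

theorem christoffel_add_christoffel_swap [I.Boundaryless] (p : M) (a b c : E) :
    g.christoffel p a b c + g.christoffel p a c b
      = fderiv ℝ (g.inChart p) (extChartAt I p p) a b c := by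
  rw [christoffel_apply, christoffel_apply, g.fderiv_inChart_symm p a c b,
    g.fderiv_inChart_symm p b a c, g.fderiv_inChart_symm p c a b]
  ring

variable [FiniteDimensional ℝ E]

theorem form_ofChart_add_christoffelVec (p : M) (x a b : E) (w : TangentSpace I p) :
    g.form p (ofChart I p p x + g.christoffelVec p a b) w
      = g.inChart p (extChartAt I p p) x (toChart I p p w)
        + g.christoffel p a b (toChart I p p w) := by
  have hp := mem_chart_source H p
  rw [g.inChart_extChartAt hp, ofChart_toChart hp, map_add, add_apply, christoffelVec,
    form_sharp, ContinuousLinearMap.comp_apply]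

theorem form_covDeriv (V : ∀ q : M, TangentSpace I q) (p : M) (a w : TangentSpace I p) :
    g.form p (g.covDeriv V p a) w
      = g.inChart p (extChartAt I p p)
          (fderiv ℝ (chartComponents V p) (extChartAt I p p) (toChart I p p a)) (toChart I p p w)
        + g.christoffel p (toChart I p p a) (toChart I p p (V p)) (toChart I p p w) :=
  g.form_ofChart_add_christoffelVec p _ _ _ w

/-- The covariant derivative `∇_{γ'} W` at time `t` of a vector field `W` along the curve `γ`,
computed in the chart centred at `γ t`: `(W^k)' + Γ^k_{ij} (γ^i)' W^j`. -/
noncomputable def covDerivAlong (γ : ℝ → M) (W : ∀ s, TangentSpace I (γ s)) (t : ℝ) :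
    TangentSpace I (γ t) :=
  ofChart I (γ t) (γ t) (deriv (fun s ↦ toChart I (γ t) (γ s) (W s)) t)
    + g.christoffelVec (γ t) (toChart I (γ t) (γ t) (velocity I γ t))
        (toChart I (γ t) (γ t) (W t))

theorem hasDerivAt_form [I.Boundaryless] {γ : ℝ → M} {t : ℝ}
    (hγ : MDifferentiableAt 𝓘(ℝ, ℝ) I γ t) {W Z : ∀ s, TangentSpace I (γ s)}
    (hW : DifferentiableAt ℝ (fun s ↦ toChart I (γ t) (γ s) (W s)) t)
    (hZ : DifferentiableAt ℝ (fun s ↦ toChart I (γ t) (γ s) (Z s)) t) :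
    HasDerivAt (fun s ↦ g.form (γ s) (W s) (Z s))
      (g.form (γ t) (g.covDerivAlong γ W t) (Z t) + g.form (γ t) (W t) (g.covDerivAlong γ Z t))
      t := by
  have hp := mem_chart_source H (γ t)
  have hmetric := HasFDerivAt.comp_hasDerivAt (l := g.inChart (γ t)) t
    (g.hasFDerivAt_inChart (γ t)) (hasDerivAt_extChartAt_comp_curve hγ hp)
  have hchart := (hmetric.clm_apply hW.hasDerivAt).clm_apply hZ.hasDerivAt
  have heq : (fun s ↦ g.form (γ s) (W s) (Z s)) =ᶠ[𝓝 t] fun s ↦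
      g.inChart (γ t) (extChartAt I (γ t) (γ s)) (toChart I (γ t) (γ s) (W s))
        (toChart I (γ t) (γ s) (Z s)) := by
    filter_upwards [hγ.continuousAt ((chartAt H (γ t)).open_source.mem_nhds hp)] with s hs
    exact (g.inChart_toChart hs _ _).symm
  refine (hchart.congr_of_eventuallyEq heq).congr_deriv ?_
  rw [g.symm (γ t) (W t), covDerivAlong, covDerivAlong, form_ofChart_add_christoffelVec,
    form_ofChart_add_christoffelVec, g.inChart_symm _ _ _ (toChart I (γ t) (γ t) (W t))]
  simp only [Function.comp_apply, add_apply, ← g.christoffel_add_christoffel_swap]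
  ring

theorem covDerivAlong_velocity {γ : ℝ → M} {t : ℝ}
    (hγ : ∀ᶠ s in 𝓝 t, MDifferentiableAt 𝓘(ℝ, ℝ) I γ s) :
    g.covDerivAlong γ (velocity I γ) t = g.acceleration γ t := by
  have hp := mem_chart_source H (γ t)
  have hsource : ∀ᶠ s in 𝓝 t, γ s ∈ (chartAt H (γ t)).source :=
    hγ.self_of_nhds.continuousAt ((chartAt H (γ t)).open_source.mem_nhds hp)
  have hderiv : deriv (fun s ↦ extChartAt I (γ t) (γ s)) =ᶠ[𝓝 t]
      fun s ↦ toChart I (γ t) (γ s) (velocity I γ s) := by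
    filter_upwards [hγ, hsource] with s hs hs'
    exact (hasDerivAt_extChartAt_comp_curve hs hs').deriv
  rw [acceleration, iteratedDeriv_succ, iteratedDeriv_one, hderiv.deriv_eq, hderiv.self_of_nhds]
  rfl

theorem covDerivAlong_comp [I.Boundaryless] {V : ∀ q : M, TangentSpace I q} {γ : ℝ → M} {t : ℝ}
    (hV : MDiffAt (T% V) (γ t)) (hγ : MDifferentiableAt 𝓘(ℝ, ℝ) I γ t) :
    g.covDerivAlong γ (fun s ↦ V (γ s)) t = g.covDeriv V (γ t) (velocity I γ t) := by
  rw [covDerivAlong, (hasDerivAt_toChart_comp_curve hV hγ).deriv]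
  rfl

namespace IsGeodesicOn

variable {g} {γ : ℝ → M} {J : Set ℝ}

theorem contMDiffAt (hγ : g.IsGeodesicOn γ J) (hJ : IsOpen J) {t : ℝ} (ht : t ∈ J) :
    ContMDiffAt 𝓘(ℝ, ℝ) I ∞ γ t :=
  hγ.1.contMDiffAt (hJ.mem_nhds ht)

theorem mdifferentiableAt (hγ : g.IsGeodesicOn γ J) (hJ : IsOpen J) {t : ℝ} (ht : t ∈ J) :
    MDifferentiableAt 𝓘(ℝ, ℝ) I γ t :=
  (hγ.contMDiffAt hJ ht).mdifferentiableAt (by simp)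

theorem differentiableAt_toChart_velocity (hγ : g.IsGeodesicOn γ J) (hJ : IsOpen J) {t : ℝ}
    (ht : t ∈ J) : DifferentiableAt ℝ (fun s ↦ toChart I (γ t) (γ s) (velocity I γ s)) t :=
  _root_.differentiableAt_toChart_velocity ((hγ.contMDiffAt hJ ht).of_le ENat.LEInfty.out)

theorem covDerivAlong_velocity_eq_zero (hγ : g.IsGeodesicOn γ J) (hJ : IsOpen J) {t : ℝ}
    (ht : t ∈ J) : g.covDerivAlong γ (velocity I γ) t = 0 :=
  (g.covDerivAlong_velocity ((hJ.eventually_mem ht).mono fun _ ↦ hγ.mdifferentiableAt hJ)).trans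
    (hγ.2 t ht)

variable [I.Boundaryless]

theorem hasDerivAt_form_velocity (hγ : g.IsGeodesicOn γ J) (hJ : IsOpen J) {t : ℝ} (ht : t ∈ J)
    {W : ∀ s, TangentSpace I (γ s)}
    (hW : DifferentiableAt ℝ (fun s ↦ toChart I (γ t) (γ s) (W s)) t) :
    HasDerivAt (fun s ↦ g.form (γ s) (W s) (velocity I γ s))
      (g.form (γ t) (g.covDerivAlong γ W t) (velocity I γ t)) t := by
  refine (g.hasDerivAt_form (hγ.mdifferentiableAt hJ ht) hW
    (hγ.differentiableAt_toChart_velocity hJ ht)).congr_deriv ?_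
  rw [hγ.covDerivAlong_velocity_eq_zero hJ ht, map_zero, add_zero]

theorem form_velocity_eq (hγ : g.IsGeodesicOn γ J) (hJ : IsOpen J) (hJc : IsPreconnected J)
    {s t : ℝ} (hs : s ∈ J) (ht : t ∈ J) :
    g.form (γ s) (velocity I γ s) (velocity I γ s)
      = g.form (γ t) (velocity I γ t) (velocity I γ t) := by
  refine eq_of_hasDerivAt_zero (f := fun s ↦ g.form (γ s) (velocity I γ s) (velocity I γ s))
    hJ hJc (fun s hs ↦ ?_) hs ht
  refine (hγ.hasDerivAt_form_velocity hJ hs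
    (hγ.differentiableAt_toChart_velocity hJ hs)).congr_deriv ?_
  rw [hγ.covDerivAlong_velocity_eq_zero hJ hs, map_zero, zero_apply]

end IsGeodesicOn

end LeviCivita

section Obata

variable {E : Type*} [NormedAddCommGroup E] [NormedSpace ℝ E] [FiniteDimensional ℝ E]
  {H : Type*} [TopologicalSpace H] {I : ModelWithCorners ℝ E H}
  {M : Type*} [TopologicalSpace M] [ChartedSpace H M] [IsManifold I ∞ M]

/-- A smooth function `u` solving Obata's equation `Hess u = c u g`, written as `∇_a ∇u = c u a`.
The differentiability of `∇u` is a field because `covDeriv` is meaningful only for a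
differentiable vector field. -/
structure IsObataFunction (g : SemiRiemannianMetric I M) (u : M → ℝ) (c : ℝ) : Prop where
  contMDiff : ContMDiff I 𝓘(ℝ, ℝ) ∞ u
  mdifferentiable_gradient : MDiff (T% (g.gradient u))
  covDeriv_gradient (p : M) (a : TangentSpace I p) :
    g.covDeriv (g.gradient u) p a = (c * u p) • a

theorem form_gradient (g : SemiRiemannianMetric I M) (u : M → ℝ) (p : M) (w : TangentSpace I p) :
    g.form p (g.gradient u p) w = mfderiv I 𝓘(ℝ, ℝ) u p w :=
  g.form_sharp p _ w

namespace IsObataFunction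

variable {g : SemiRiemannianMetric I M} {u : M → ℝ} {c : ℝ} {γ : ℝ → M} {J : Set ℝ}

theorem hasDerivAt_comp (hu : g.IsObataFunction u c) {t : ℝ}
    (hγ : MDifferentiableAt 𝓘(ℝ, ℝ) I γ t) :
    HasDerivAt (u ∘ γ) (g.form (γ t) (g.gradient u (γ t)) (velocity I γ t)) t := by
  rw [form_gradient]
  exact hasDerivAt_comp_curve (hu.contMDiff.mdifferentiable (by simp) (γ t)) hγ

theorem contDiffOn_comp (hu : g.IsObataFunction u c) (hγ : g.IsGeodesicOn γ J) :
    ContDiffOn ℝ ∞ (u ∘ γ) J :=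
  contMDiffOn_iff_contDiffOn.1 (hu.contMDiff.comp_contMDiffOn hγ.1)

variable [I.Boundaryless]

theorem hasDerivAt_form_gradient_velocity (hu : g.IsObataFunction u c)
    (hγ : g.IsGeodesicOn γ J) (hJ : IsOpen J) {t : ℝ} (ht : t ∈ J) :
    HasDerivAt (fun s ↦ g.form (γ s) (g.gradient u (γ s)) (velocity I γ s))
      (c * u (γ t) * g.form (γ t) (velocity I γ t) (velocity I γ t)) t := by
  have hγt := hγ.mdifferentiableAt hJ ht
  have hgrad := hu.mdifferentiable_gradient (γ t)
  refine (hγ.hasDerivAt_form_velocity hJ ht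
    (hasDerivAt_toChart_comp_curve hgrad hγt).differentiableAt).congr_deriv ?_
  rw [g.covDerivAlong_comp hgrad hγt, hu.covDeriv_gradient, map_smul, smul_apply, smul_eq_mul]

theorem hasDerivAt_form_gradient_velocity_of_speed (hu : g.IsObataFunction u c)
    (hγ : g.IsGeodesicOn γ J) (hJ : IsOpen J) (hJc : IsPreconnected J) (h0 : 0 ∈ J)
    (hspeed : c * g.form (γ 0) (velocity I γ 0) (velocity I γ 0) = 1) {t : ℝ} (ht : t ∈ J) :
    HasDerivAt (fun s ↦ g.form (γ s) (g.gradient u (γ s)) (velocity I γ s)) ((u ∘ γ) t) t := by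
  refine (hu.hasDerivAt_form_gradient_velocity hγ hJ ht).congr_deriv ?_
  rw [hγ.form_velocity_eq hJ hJc ht h0, Function.comp_apply]
  linear_combination u (γ t) * hspeed

theorem iteratedDeriv_two_comp (hu : g.IsObataFunction u c)
    (hγ : g.IsGeodesicOn γ J) (hJ : IsOpen J) (hJc : IsPreconnected J) (h0 : 0 ∈ J)
    (hspeed : c * g.form (γ 0) (velocity I γ 0) (velocity I γ 0) = 1) {t : ℝ} (ht : t ∈ J) :
    iteratedDeriv 2 (u ∘ γ) t = (u ∘ γ) t :=
  iteratedDeriv_two_eq_of_hasDerivAt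
    ((hJ.eventually_mem ht).mono fun _ hs ↦ hu.hasDerivAt_comp (hγ.mdifferentiableAt hJ hs))
    (hu.hasDerivAt_form_gradient_velocity_of_speed hγ hJ hJc h0 hspeed ht)

theorem comp_eq_cosh_add_sinh (hu : g.IsObataFunction u c)
    (hγ : g.IsGeodesicOn γ J) (hJ : IsOpen J) (hJc : IsPreconnected J) (h0 : 0 ∈ J)
    (hspeed : c * g.form (γ 0) (velocity I γ 0) (velocity I γ 0) = 1) {t : ℝ} (ht : t ∈ J) :
    (u ∘ γ) t = u (γ 0) * Real.cosh t
      + g.form (γ 0) (g.gradient u (γ 0)) (velocity I γ 0) * Real.sinh t :=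
  eq_cosh_add_sinh_of_hasDerivAt hJ hJc h0
    (fun _ hs ↦ hu.hasDerivAt_comp (hγ.mdifferentiableAt hJ hs))
    (fun _ hs ↦ hu.hasDerivAt_form_gradient_velocity_of_speed hγ hJ hJc h0 hspeed hs) ht

theorem mul_exp_mem_range (hu : g.IsObataFunction u c) (hg : g.IsComplete) (hc : c ≠ 0) {p : M}
    (hp : u p ≠ 0) (hgrad : g.form p (g.gradient u p) (g.gradient u p) = c * u p ^ 2) (t : ℝ) :
    u p * Real.exp t ∈ range u := by
  -- With this initial velocity, `f = u ∘ γ` satisfies `f'(0) = f(0)`.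
  obtain ⟨γ, hγ, hinit⟩ := hg ⟨p, (c * u p)⁻¹ • g.gradient u p⟩
  have hspeed := congrArg (fun ξ : TangentBundle I M ↦ c * g.form ξ.1 ξ.2 ξ.2) hinit
  have hslope := congrArg (fun ξ : TangentBundle I M ↦ g.form ξ.1 (g.gradient u ξ.1) ξ.2) hinit
  have hpoint : γ 0 = p := congrArg (fun ξ : TangentBundle I M ↦ ξ.1) hinit
  simp only [map_smul, smul_apply, smul_eq_mul, hgrad] at hspeed hslope
  have hformula := hu.comp_eq_cosh_add_sinh hγ isOpen_univ isPreconnected_univ (mem_univ 0)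
    (hspeed.trans (by field_simp)) (mem_univ t)
  refine ⟨γ t, hformula.trans ?_⟩
  rw [hslope, hpoint, ← Real.cosh_add_sinh]
  field_simp

theorem mem_range_of_mul_pos (hu : g.IsObataFunction u c) (hg : g.IsComplete) (hc : c ≠ 0) {p : M}
    (hgrad : g.form p (g.gradient u p) (g.gradient u p) = c * u p ^ 2) {y : ℝ}
    (hy : 0 < y * u p) : y ∈ range u := by
  have hp : u p ≠ 0 := right_ne_zero_of_mul hy.ne'
  have hquot : 0 < y / u p := div_pos_iff.2 (mul_pos_iff.1 hy)
  have := hu.mul_exp_mem_range hg hc hp hgrad (Real.log (y / u p))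
  rwa [Real.exp_log hquot, mul_div_cancel₀ _ hp] at this

end IsObataFunction

end Obata

end SemiRiemannianMetric

section ConeCharts

variable {E : Type*} [NormedAddCommGroup E] [NormedSpace ℝ E]
  {H : Type*} [TopologicalSpace H] {I : ModelWithCorners ℝ E H}
  {M : Type*} [TopologicalSpace M] [ChartedSpace H M]

theorem extChartAt_posReals (r₀ r : posReals) : extChartAt 𝓘(ℝ, ℝ) r₀ r = (r : ℝ) := by
  simp [TopologicalSpace.Opens.chartAt_eq, chartAt_self_eq]

theorem coe_extChartAt_posReals_symm (r₀ : posReals) {s : ℝ} (hs : 0 < s) :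
    ((extChartAt 𝓘(ℝ, ℝ) r₀).symm s : ℝ) = s := by
  have hmem : (⟨s, hs⟩ : posReals) ∈ (extChartAt 𝓘(ℝ, ℝ) r₀).source := by
    rw [extChartAt_source]
    exact mem_chartAt_posReals r₀ _
  have hinv := congrArg Subtype.val ((extChartAt 𝓘(ℝ, ℝ) r₀).left_inv hmem)
  rwa [extChartAt_posReals] at hinv

theorem extChartAt_cone (q₀ q : Cone M) :
    extChartAt (coneModel I) q₀ q = ((q.1 : ℝ), extChartAt I q₀.2 q.2) := by
  rw [extChartAt_prod]
  exact Prod.ext (extChartAt_posReals _ _) rfl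

theorem extChartAt_cone_symm (q₀ : Cone M) (y : ℝ × E) :
    (extChartAt (coneModel I) q₀).symm y
      = ((extChartAt 𝓘(ℝ, ℝ) q₀.1).symm y.1, (extChartAt I q₀.2).symm y.2) := by
  rw [extChartAt_prod]
  rfl

theorem extChartAt_cone_symm_coe (q₀ : Cone M) (r : posReals) (x : E) :
    (extChartAt (coneModel I) q₀).symm ((r : ℝ), x) = (r, (extChartAt I q₀.2).symm x) := by
  rw [extChartAt_cone_symm]
  exact Prod.ext (Subtype.ext (coe_extChartAt_posReals_symm q₀.1 r.2)) rfl

variable [IsManifold I ∞ M]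

theorem trivializationAt_cone_apply {q₀ q : Cone M} (hq : q.2 ∈ (chartAt H q₀.2).source)
    (v : TangentSpace (coneModel I) q) :
    (trivializationAt (ℝ × E) (TangentSpace (coneModel I)) q₀ ⟨q, v⟩).2
      = (coneDr I q v,
          (trivializationAt E (TangentSpace I) q₀.2 ⟨q.2, coneDproj I q v⟩).2) := by
  rw [trivializationAt_tangentSpace_apply (mem_chartAt_cone q₀ q hq),
    trivializationAt_tangentSpace_apply hq, toChart_cone q₀ q hq]

theorem toChart_cone_self (q : Cone M) (v : TangentSpace (coneModel I) q) :
    toChart (coneModel I) q q v = (coneDr I q v, toChart I q.2 q.2 (coneDproj I q v)) :=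
  toChart_cone q q (mem_chart_source H q.2) v

variable [I.Boundaryless] (g : SemiRiemannianMetric I M) (ε : ℝ) (hε : ε = 1 ∨ ε = -1)

theorem inChart_coneMetric_eventuallyEq (q : Cone M) (b c : ℝ × E) :
    (fun y ↦ (coneMetric g ε hε).inChart q y b c) =ᶠ[𝓝 (extChartAt (coneModel I) q q)]
      fun y ↦ ε * (b.1 * c.1) + y.1 ^ 2 * g.inChart q.2 y.2 b.2 c.2 := by
  rw [extChartAt_cone]
  filter_upwards [continuousAt_fst.eventually (lt_mem_nhds q.1.2),
    continuousAt_snd.eventually (eventually_extChartAt_symm_mem_source (I := I) q.2)]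
    with y hradius hsource
  change coneForm g ε ((extChartAt (coneModel I) q).symm y)
    (ofChart (coneModel I) q ((extChartAt (coneModel I) q).symm y) b)
    (ofChart (coneModel I) q ((extChartAt (coneModel I) q).symm y) c) = _
  rw [extChartAt_cone_symm, ofChart_cone q (_, _) hsource, ofChart_cone q (_, _) hsource]
  refine (coneForm_apply g ε _ _ _).trans ?_
  rw [coe_extChartAt_posReals_symm _ hradius]
  rfl

theorem inChart_coneMetric (q : Cone M) (b c : ℝ × E) :
    (coneMetric g ε hε).inChart q (extChartAt (coneModel I) q q) b c
      = ε * (b.1 * c.1)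
        + (q.1 : ℝ) ^ 2 * g.inChart q.2 (extChartAt I q.2 q.2) b.2 c.2 := by
  have h := (inChart_coneMetric_eventuallyEq g ε hε q b c).self_of_nhds
  rwa [extChartAt_cone] at h ⊢

theorem fderiv_inChart_coneMetric (q : Cone M) (a b c : ℝ × E) :
    fderiv ℝ ((coneMetric g ε hε).inChart q) (extChartAt (coneModel I) q q) a b c
      = 2 * (q.1 : ℝ) * a.1 * g.inChart q.2 (extChartAt I q.2 q.2) b.2 c.2
        + (q.1 : ℝ) ^ 2
          * fderiv ℝ (g.inChart q.2) (extChartAt I q.2 q.2) a.2 b.2 c.2 := by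
  have hcone := (coneMetric g ε hε).hasFDerivAt_inChart_apply q b c
  have hformula := inChart_coneMetric_eventuallyEq g ε hε q b c
  rw [extChartAt_cone] at hcone hformula ⊢
  have hbase := HasFDerivAt.comp (g := fun x ↦ g.inChart q.2 x b.2 c.2) (f := Prod.snd)
    ((q.1 : ℝ), extChartAt I q.2 q.2) (g.hasFDerivAt_inChart_apply q.2 b.2 c.2) hasFDerivAt_snd
  have hsq := (hasFDerivAt_fst (𝕜 := ℝ) (p := ((q.1 : ℝ), extChartAt I q.2 q.2))).pow 2
  have heq := congrArg (fun L : (ℝ × E) →L[ℝ] ℝ ↦ L a) (hcone.unique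
    (((hsq.mul hbase).const_add (ε * (b.1 * c.1))).congr_of_eventuallyEq hformula))
  simp only [ContinuousLinearMap.flip_apply, add_apply, smul_apply, Function.comp_apply,
    ContinuousLinearMap.comp_apply, ContinuousLinearMap.coe_snd', ContinuousLinearMap.coe_fst',
    smul_eq_mul, nsmul_eq_mul] at heq
  rw [heq]
  push_cast
  ring

theorem christoffel_coneMetric (q : Cone M) (a b c : ℝ × E) :
    (coneMetric g ε hε).christoffel q a b c
      = (q.1 : ℝ) * a.1 * g.inChart q.2 (extChartAt I q.2 q.2) b.2 c.2
        + (q.1 : ℝ) * b.1 * g.inChart q.2 (extChartAt I q.2 q.2) a.2 c.2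
        - (q.1 : ℝ) * c.1 * g.inChart q.2 (extChartAt I q.2 q.2) a.2 b.2
        + (q.1 : ℝ) ^ 2 * g.christoffel q.2 a.2 b.2 c.2 := by
  simp only [SemiRiemannianMetric.christoffel_apply, fderiv_inChart_coneMetric]
  ring

end ConeCharts

section VectorFieldsOnCone

variable {E : Type*} [NormedAddCommGroup E] [NormedSpace ℝ E]
  {H : Type*} [TopologicalSpace H] {I : ModelWithCorners ℝ E H}
  {M : Type*} [TopologicalSpace M] [ChartedSpace H M]

/-- The vector `(0, v)` of `T_{(r, p)}(ℝ_{>0} × M) = ℝ × T_p M`. -/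
def horizontalLift (q : Cone M) (v : TangentSpace I q.2) : TangentSpace (coneModel I) q :=
  ((0, v) : ℝ × E)

/-- The component tangent to `M` of a vector field on `ℝ_{>0} × M`, restricted to the slice
`{r} × M` and regarded as a vector field on `M`. -/
noncomputable def horizontalPart (V : ∀ q : Cone M, TangentSpace (coneModel I) q) (r : posReals)
    (p : M) : TangentSpace I p :=
  coneDproj I (r, p) (V (r, p))

/-- The function `ĝ(V, ∂_r) = ε dr(V)` on the cone. -/
noncomputable def radialPairing (ε : ℝ) (V : ∀ q : Cone M, TangentSpace (coneModel I) q)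
    (q : Cone M) : ℝ :=
  ε * coneDr I q (V q)

variable [IsManifold I ∞ M]

theorem form_coneMetric_radial (g : SemiRiemannianMetric I M) (ε : ℝ) (hε : ε = 1 ∨ ε = -1)
    (V : ∀ q : Cone M, TangentSpace (coneModel I) q) (q : Cone M) :
    (coneMetric g ε hε).form q (V q) (radial I q) = radialPairing ε V q := by
  refine (coneForm_apply g ε q (V q) (radial I q)).trans ?_
  rw [show coneDr I q (radial I q) = 1 from rfl, show coneDproj I q (radial I q) = 0 from rfl,
    map_zero, mul_zero, add_zero, mul_one, radialPairing]

variable {V : ∀ q : Cone M, TangentSpace (coneModel I) q}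

theorem form_horizontalPart_self {g : SemiRiemannianMetric I M} {ε : ℝ} {hε : ε = 1 ∨ ε = -1}
    {r : posReals} {p : M} (hnull : (coneMetric g ε hε).form (r, p) (V (r, p)) (V (r, p)) = 0) :
    (r : ℝ) ^ 2 * g.form p (horizontalPart V r p) (horizontalPart V r p)
      = -ε * radialPairing ε V (r, p) ^ 2 := by
  have h := (coneForm_apply g ε (r, p) _ _).symm.trans hnull
  unfold radialPairing horizontalPart
  linear_combination h + ε * coneDr I (r, p) (V (r, p)) ^ 2 * sq_eq_one_iff.2 hε

theorem radialPairing_eventuallyEq (ε : ℝ) (V : ∀ q : Cone M, TangentSpace (coneModel I) q)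
    (q : Cone M) :
    radialPairing ε V =ᶠ[𝓝 q] fun q' ↦ ε * ContinuousLinearMap.fst ℝ ℝ E
      (trivializationAt (ℝ × E) (TangentSpace (coneModel I)) q ⟨q', V q'⟩).2 := by
  filter_upwards [continuousAt_snd.eventually
    ((chartAt H q.2).open_source.mem_nhds (mem_chart_source H q.2))] with q' hq'
  exact (congrArg (fun x ↦ ε * x.1) (trivializationAt_cone_apply hq' (V q'))).symm

theorem contMDiff_radialPairing (ε : ℝ) {n : ℕ∞}
    (hV : ContMDiff (coneModel I) ((coneModel I).prod 𝓘(ℝ, ℝ × E)) n (T% V)) :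
    ContMDiff (coneModel I) 𝓘(ℝ, ℝ) n (radialPairing ε V) := fun q ↦
  (contMDiffAt_const.mul ((ContinuousLinearMap.fst ℝ ℝ E).contMDiff.contMDiffAt.comp q
    ((Bundle.contMDiffAt_section q).1 (hV q)))).congr_of_eventuallyEq
      (radialPairing_eventuallyEq ε V q)

theorem mdifferentiableAt_radialPairing (ε : ℝ) {q : Cone M}
    (hV : MDifferentiableAt (coneModel I) ((coneModel I).prod 𝓘(ℝ, ℝ × E)) (T% V) q) :
    MDifferentiableAt (coneModel I) 𝓘(ℝ, ℝ) (radialPairing ε V) q :=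
  (mdifferentiableAt_const.mul ((ContinuousLinearMap.fst ℝ ℝ E).mdifferentiableAt.comp q
    ((mdifferentiableAt_section _ _).1 hV))).congr_of_eventuallyEq
      (radialPairing_eventuallyEq ε V q)

theorem mdifferentiableAt_horizontalPart {r : posReals} {p : M}
    (hV : MDifferentiableAt (coneModel I) ((coneModel I).prod 𝓘(ℝ, ℝ × E)) (T% V) (r, p)) :
    MDiffAt (T% (horizontalPart V r)) p := by
  rw [mdifferentiableAt_section] at hV ⊢
  have hslice : MDifferentiableAt I (coneModel I) (fun p' : M ↦ ((r, p') : Cone M)) p :=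
    mdifferentiableAt_const.prodMk mdifferentiableAt_id
  refine ((ContinuousLinearMap.snd ℝ ℝ E).mdifferentiableAt.comp p
    (hV.comp p hslice)).congr_of_eventuallyEq ?_
  filter_upwards [(chartAt H p).open_source.mem_nhds (mem_chart_source H p)] with p' hp'
  exact (congrArg Prod.snd
    (trivializationAt_cone_apply (q₀ := (r, p)) (q := (r, p')) hp' (V (r, p')))).symm

theorem chartComponents_cone {q : Cone M} {y : ℝ × E}
    (hy : (extChartAt (coneModel I) q).symm y ∈ (chartAt (ModelProd ℝ H) q).source) :
    chartComponents V q y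
      = (coneDr I _ (V ((extChartAt (coneModel I) q).symm y)),
          toChart I q.2 _ (coneDproj I _ (V ((extChartAt (coneModel I) q).symm y)))) :=
  toChart_cone q _ hy.2 _

theorem chartComponents_horizontalPart {r : posReals} {p : M} {x : E}
    (hx : (extChartAt I p).symm x ∈ (chartAt H p).source) :
    chartComponents (horizontalPart V r) p x = (chartComponents V (r, p) ((r : ℝ), x)).2 := by
  have hsymm := extChartAt_cone_symm_coe (I := I) (r, p) r x
  rw [chartComponents_cone (by rw [hsymm]; exact mem_chartAt_cone (r, p) (r, _) hx), hsymm]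
  rfl

variable [I.Boundaryless]

theorem fderiv_chartComponents_horizontalPart {r : posReals} {p : M}
    (hV : MDifferentiableAt (coneModel I) ((coneModel I).prod 𝓘(ℝ, ℝ × E)) (T% V) (r, p))
    (a : E) :
    fderiv ℝ (chartComponents (horizontalPart V r) p) (extChartAt I p p) a
      = (fderiv ℝ (chartComponents V (r, p))
          (extChartAt (coneModel I) ((r, p) : Cone M) (r, p)) (0, a)).2 := by
  have hcone := hasFDerivAt_chartComponents hV
  rw [extChartAt_cone] at hcone ⊢
  have hslice : HasFDerivAt (fun x : E ↦ ((r : ℝ), x)) _ (extChartAt I p p) :=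
    hasFDerivAt_prodMk_right (𝕜 := ℝ) (r : ℝ) (extChartAt I p p)
  have hcomp := (HasFDerivAt.comp (g := chartComponents V (r, p)) (f := fun x ↦ ((r : ℝ), x))
    (extChartAt I p p) hcone hslice).snd
  have heq := (eventually_extChartAt_symm_mem_source (I := I) p).mono
    fun x hx ↦ chartComponents_horizontalPart (V := V) (r := r) hx
  rw [(hcomp.congr_of_eventuallyEq heq).fderiv]
  rfl

theorem mfderiv_radialPairing_eq_fderiv (ε : ℝ) {q : Cone M}
    (hV : MDifferentiableAt (coneModel I) ((coneModel I).prod 𝓘(ℝ, ℝ × E)) (T% V) q)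
    (a : TangentSpace (coneModel I) q) :
    mfderiv (coneModel I) 𝓘(ℝ, ℝ) (radialPairing ε V) q a
      = ε * (fderiv ℝ (chartComponents V q) (extChartAt (coneModel I) q q)
          (toChart (coneModel I) q q a)).1 := by
  have heq : (fun y ↦ radialPairing ε V ((extChartAt (coneModel I) q).symm y))
      =ᶠ[𝓝 (extChartAt (coneModel I) q q)] fun y ↦ ε * (chartComponents V q y).1 := by
    filter_upwards [eventually_extChartAt_symm_mem_source (I := coneModel I) q] with y hy
    rw [chartComponents_cone hy]
    rfl
  rw [mfderiv_eq_fderiv_comp_toChart (mdifferentiableAt_radialPairing ε hV), heq.fderiv_eq,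
    ((hasFDerivAt_chartComponents hV).fst.const_mul ε).fderiv]
  rfl

variable [FiniteDimensional ℝ E] (g : SemiRiemannianMetric I M) {ε : ℝ} (hε : ε = 1 ∨ ε = -1)

theorem mfderiv_radialPairing {q : Cone M}
    (hV : MDifferentiableAt (coneModel I) ((coneModel I).prod 𝓘(ℝ, ℝ × E)) (T% V) q)
    (a : TangentSpace (coneModel I) q) :
    mfderiv (coneModel I) 𝓘(ℝ, ℝ) (radialPairing ε V) q a
      = (coneMetric g ε hε).form q ((coneMetric g ε hε).covDeriv V q a) (radial I q)
        + (q.1 : ℝ) * g.form q.2 (coneDproj I q a) (coneDproj I q (V q)) := by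
  have hradial : toChart (coneModel I) q q (radial I q) = (1, 0) :=
    (toChart_cone_self q _).trans (Prod.ext rfl (map_zero _))
  refine (mfderiv_radialPairing_eq_fderiv ε hV a).trans ?_
  rw [SemiRiemannianMetric.form_covDeriv, inChart_coneMetric, christoffel_coneMetric, hradial,
    ← g.inChart_toChart (mem_chart_source H q.2)]
  simp only [toChart_cone_self, map_zero, mul_zero, mul_one, add_zero, zero_sub,
    neg_add_cancel_right]
  rfl

theorem form_covDeriv_horizontalLift {r : posReals} {p : M}
    (hV : MDifferentiableAt (coneModel I) ((coneModel I).prod 𝓘(ℝ, ℝ × E)) (T% V) (r, p))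
    (a w : TangentSpace I p) :
    (coneMetric g ε hε).form (r, p)
        ((coneMetric g ε hε).covDeriv V (r, p) (horizontalLift (r, p) a))
        (horizontalLift (r, p) w)
      = (r : ℝ) ^ 2 * g.form p (g.covDeriv (horizontalPart V r) p a) w
        + r * coneDr I (r, p) (V (r, p)) * g.form p a w := by
  have hp := mem_chart_source H p
  rw [SemiRiemannianMetric.form_covDeriv, SemiRiemannianMetric.form_covDeriv,
    inChart_coneMetric, christoffel_coneMetric, fderiv_chartComponents_horizontalPart hV,
    ← g.inChart_toChart hp a w]
  have hlift (v : TangentSpace I p) :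
      toChart (coneModel I) (r, p) (r, p) (horizontalLift (r, p) v) = (0, toChart I p p v) :=
    toChart_cone_self (r, p) _
  rw [hlift, hlift, toChart_cone_self]
  simp only [horizontalPart]
  ring

variable {g hε}

theorem mfderiv_radialPairing_of_isParallel (hpar : (coneMetric g ε hε).IsParallel V)
    (q : Cone M) (a : TangentSpace (coneModel I) q) :
    mfderiv (coneModel I) 𝓘(ℝ, ℝ) (radialPairing ε V) q a
      = (q.1 : ℝ) * g.form q.2 (coneDproj I q a) (coneDproj I q (V q)) := by
  refine (mfderiv_radialPairing g hε (hpar.1.mdifferentiable (by simp) q) a).trans ?_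
  rw [hpar.2, map_zero, zero_apply, zero_add]

/-- The radius `r = 1`, at which the slice `{r} × M` of the cone is isometric to `(M, g)`. -/
def unitRadius : posReals := ⟨1, mem_Ioi.2 one_pos⟩

theorem coe_unitRadius : (unitRadius : ℝ) = 1 := rfl

theorem radialPairing_eq_of_isParallel (hpar : (coneMetric g ε hε).IsParallel V) (q : Cone M) :
    radialPairing ε V q = radialPairing ε V (unitRadius, q.2) := by
  have hdiff : MDifferentiable (coneModel I) 𝓘(ℝ, ℝ) (radialPairing ε V) :=
    (contMDiff_radialPairing ε hpar.1).mdifferentiable (by simp)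
  have hslice : MDifferentiable 𝓘(ℝ, ℝ) (coneModel I) (fun r : posReals ↦ ((r, q.2) : Cone M)) :=
    fun _ ↦ mdifferentiableAt_id.prodMk mdifferentiableAt_const
  have hvertical (r : posReals) :
      mfderiv (coneModel I) 𝓘(ℝ, ℝ) (radialPairing ε V) (r, q.2) (radial I (r, q.2)) = 0 := by
    refine (mfderiv_radialPairing_of_isParallel hpar (r, q.2) _).trans ?_
    rw [show coneDproj I (r, q.2) (radial I (r, q.2)) = 0 from rfl, map_zero, zero_apply, mul_zero]
    rfl
  have hconst : IsLocallyConstant fun r : posReals ↦ radialPairing ε V (r, q.2) := by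
    refine isLocallyConstant_of_mfderiv_eq_zero (I := 𝓘(ℝ, ℝ)) (hdiff.comp hslice) fun r ↦ ?_
    ext
    refine (congrArg (fun L : ℝ →L[ℝ] ℝ ↦ L 1)
      (mfderiv_comp (I' := coneModel I) r (hdiff (r, q.2)) (hslice r))).trans ?_
    rw [mfderiv_prod_left]
    exact hvertical r
  have : PreconnectedSpace posReals :=
    isPreconnected_iff_preconnectedSpace.1 (convex_Ioi (0 : ℝ)).isPreconnected
  exact hconst.apply_eq_of_preconnectedSpace q.1 unitRadius

theorem gradient_radialPairing_of_isParallel (hpar : (coneMetric g ε hε).IsParallel V) :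
    g.gradient (fun p ↦ radialPairing ε V (unitRadius, p)) = horizontalPart V unitRadius := by
  funext p
  refine sub_eq_zero.1 (g.nondegenerate p _ fun w ↦ ?_)
  have hslice : MDifferentiableAt I (coneModel I) (fun p' : M ↦ ((unitRadius, p') : Cone M)) p :=
    mdifferentiableAt_const.prodMk mdifferentiableAt_id
  have hderiv : mfderiv I 𝓘(ℝ, ℝ) (fun p' ↦ radialPairing ε V (unitRadius, p')) p w
      = g.form p w (horizontalPart V unitRadius p) := by
    refine (congrArg (fun L : E →L[ℝ] ℝ ↦ L w) (mfderiv_comp (I' := coneModel I) p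
      ((contMDiff_radialPairing ε hpar.1).mdifferentiable (by simp) (unitRadius, p))
      hslice)).trans ?_
    refine (mfderiv_radialPairing_of_isParallel hpar (unitRadius, p) _).trans ?_
    rw [mfderiv_prod_right, coe_unitRadius, one_mul]
    rfl
  rw [map_sub, sub_apply, g.form_gradient, hderiv, g.symm, sub_self]

theorem covDeriv_horizontalPart_of_isParallel (hpar : (coneMetric g ε hε).IsParallel V)
    (p : M) (a : TangentSpace I p) :
    g.covDeriv (horizontalPart V unitRadius) p a
      = (-ε * radialPairing ε V (unitRadius, p)) • a := by
  refine sub_eq_zero.1 (g.nondegenerate p _ fun w ↦ ?_)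
  have h := form_covDeriv_horizontalLift g hε
    (hpar.1.mdifferentiable (by simp) (unitRadius, p)) a w
  rw [hpar.2, map_zero, zero_apply, coe_unitRadius] at h
  rw [map_sub, sub_apply, map_smul, smul_apply, smul_eq_mul, radialPairing]
  linear_combination -h + coneDr I (unitRadius, p) (V (unitRadius, p)) * g.form p a w *
    sq_eq_one_iff.2 hε

theorem isObataFunction_radialPairing (hpar : (coneMetric g ε hε).IsParallel V) :
    g.IsObataFunction (fun p ↦ radialPairing ε V (unitRadius, p)) (-ε) where
  contMDiff := (contMDiff_radialPairing ε hpar.1).comp (contMDiff_const.prodMk contMDiff_id)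
  mdifferentiable_gradient p := by
    rw [gradient_radialPairing_of_isParallel hpar]
    exact mdifferentiableAt_horizontalPart (hpar.1.mdifferentiable (by simp) _)
  covDeriv_gradient p a := by
    rw [gradient_radialPairing_of_isParallel hpar, covDeriv_horizontalPart_of_isParallel hpar]

end VectorFieldsOnCone

theorem mainTheorem8_general
    {E : Type*} [NormedAddCommGroup E] [NormedSpace ℝ E] [FiniteDimensional ℝ E]
    {H : Type*} [TopologicalSpace H] {I : ModelWithCorners ℝ E H} [I.Boundaryless]
    {M : Type*} [TopologicalSpace M] [ChartedSpace H M] [IsManifold I ∞ M]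
    (g : SemiRiemannianMetric I M) (ε : ℝ) (hε : ε = 1 ∨ ε = -1)
    (V : ∀ q : Cone M, TangentSpace (coneModel I) q)
    (hpar : (coneMetric g ε hε).IsParallel V) :
    ∃ u : M → ℝ,
      ContMDiff I 𝓘(ℝ, ℝ) ∞ u ∧
      (∀ q : Cone M, (coneMetric g ε hε).form q (V q) (radial I q) = u q.2) ∧
      (∀ (J : Set ℝ) (γ : ℝ → M), IsOpen J → J.OrdConnected → (0 : ℝ) ∈ J →
        g.IsGeodesicOn γ J →
        g.form (γ 0) (velocity I γ 0) (velocity I γ 0) = -ε →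
        ContDiffOn ℝ ∞ (u ∘ γ) J ∧
        (∀ t ∈ J, iteratedDeriv 2 (u ∘ γ) t = (u ∘ γ) t) ∧
        (∀ t ∈ J, (u ∘ γ) t = u (γ 0) * Real.cosh t
          + g.form (γ 0) (g.gradient u (γ 0)) (velocity I γ 0) * Real.sinh t)) ∧
      ((∀ q, (coneMetric g ε hε).form q (V q) (V q) = 0) → g.IsComplete →
        ((∃ p, 0 < u p) → Ioi 0 ⊆ range u) ∧
        ((∃ p, u p < 0) → Iio 0 ⊆ range u)) := by
  have hu := isObataFunction_radialPairing hpar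
  refine ⟨_, hu.contMDiff, fun q ↦ ?_, fun J γ hJ hJc h0 hγ hspeed ↦ ?_, fun hnull hg ↦ ?_⟩
  · rw [form_coneMetric_radial, radialPairing_eq_of_isParallel hpar]
  · have hc : -ε * g.form (γ 0) (velocity I γ 0) (velocity I γ 0) = 1 := by
      rw [hspeed, neg_mul_neg, ← sq, sq_eq_one_iff.2 hε]
    exact ⟨hu.contDiffOn_comp hγ,
      fun _ ↦ hu.iteratedDeriv_two_comp hγ hJ hJc.isPreconnected h0 hc,
      fun _ ↦ hu.comp_eq_cosh_add_sinh hγ hJ hJc.isPreconnected h0 hc⟩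
  · have hc : -ε ≠ 0 := by rcases hε with rfl | rfl <;> norm_num
    have hgrad (p : M) := form_horizontalPart_self (hnull (unitRadius, p))
    simp only [coe_unitRadius, one_pow, one_mul,
      ← gradient_radialPairing_of_isParallel hpar] at hgrad
    exact ⟨fun ⟨p, hp⟩ y hy ↦ hu.mem_range_of_mul_pos hg hc (hgrad p) (mul_pos hy hp),
      fun ⟨p, hp⟩ y hy ↦ hu.mem_range_of_mul_pos hg hc (hgrad p) (mul_pos_of_neg_of_neg hy hp)⟩

theorem mainTheorem8
    {E : Type*} [NormedAddCommGroup E] [NormedSpace ℝ E] [FiniteDimensional ℝ E]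
    {H : Type*} [TopologicalSpace H] {I : ModelWithCorners ℝ E H} [I.Boundaryless]
    {M : Type*} [TopologicalSpace M] [ChartedSpace H M] [IsManifold I ∞ M] [T2Space M]
    (g : SemiRiemannianMetric I M) (ε : ℝ) (hε : ε = 1 ∨ ε = -1)
    (V : ∀ q : Cone M, TangentSpace (coneModel I) q)
    (hpar : (coneMetric g ε hε).IsParallel V)
    (hlight : ∀ q, (coneMetric g ε hε).IsLightLike q (V q)) :
    ∃ u : M → ℝ,
      ContMDiff I 𝓘(ℝ, ℝ) ∞ u ∧
      (∀ q : Cone M, (coneMetric g ε hε).form q (V q) (radial I q) = u q.2) ∧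
      (∀ (J : Set ℝ) (γ : ℝ → M), IsOpen J → J.OrdConnected → (0 : ℝ) ∈ J →
        g.IsGeodesicOn γ J →
        g.form (γ 0) (velocity I γ 0) (velocity I γ 0) = -ε →
        ContDiffOn ℝ ∞ (u ∘ γ) J ∧
        (∀ t ∈ J, iteratedDeriv 2 (u ∘ γ) t = (u ∘ γ) t) ∧
        (∀ t ∈ J, (u ∘ γ) t = u (γ 0) * Real.cosh t
          + g.form (γ 0) (g.gradient u (γ 0)) (velocity I γ 0) * Real.sinh t)) ∧
      (g.IsComplete →
        ((∃ p, 0 < u p) → Ioi 0 ⊆ range u) ∧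
        ((∃ p, u p < 0) → Iio 0 ⊆ range u)) := by
  obtain ⟨u, hu, hform, hgeodesic, hrange⟩ := mainTheorem8_general g ε hε V hpar
  exact ⟨u, hu, hform, hgeodesic, hrange fun q ↦ (hlight q).2⟩
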